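/- A \emph{graphing} is a quadruple $\mathcal G=(V,\mathcal B,E,\mu)$ where $(V,\mathcal B)$ is a standard Borel space, $E\subseteq V\times V$ is a Borel, symmetric and anti-reflexive relation (the edge set), $\mu$ is a probability measure on $(V,\mathcal B)$, and there are finitely many invertible Borel bijections $\phi_i:A_i\to B_i$ ($1\le i\le n$) with $A_i,B_i\in\mathcal B$, each preserving the measure $\mu$, such that distinct $x,y\in V$ are adjacent if and only if $\phi_i(x)=y$ or $\phi_i(y)=x$ for some $i$. (A set of edges is Borel if the corresponding symmetric subset of $V\times V$ is Borel; a matching is a set of pairwise disjoint edges, not necessarily covering all vertices.) Let $\mathcal G=(V,\mathcal B,E,\mu)$ be a graphing, let $k\ge 0$, and let $E=F_0\cup F_1\cup\dots\cup F_k$ be a partition of its edge set into (possibly empty) Borel sets such that $F_0$ is a matching and, for each $1\le j\le k$, every vertex is incident to at most $2$ edges of $F_j$. Then there is a Borel matching $M\subseteq E$ such that the set of vertices lying in infinite connectivity components of the graph $(V,F_0\cup M)$ has $\mu$-measure zero and, for each $1\le j\le k$, the set of vertices lying in infinite connectivity components of the graph $(V,F_j\setminus M)$ has $\mu$-measure zero.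 -/

import Mathlib

open MeasureTheory

/-- The set of ordered pairs of adjacent vertices is a Borel subset of `V × V`. A symmetric
anti-reflexive relation on `V` (equivalently, a set of edges) is a `SimpleGraph V`. -/
def IsBorelGraph {V : Type*} [MeasurableSpace V] (G : SimpleGraph V) : Prop :=
  MeasurableSet {p : V × V | G.Adj p.1 p.2}

/-- A set of edges (given as a graph on `V`) is a matching if its edges are pairwise disjoint;
not every vertex has to be covered. -/
def IsEdgeMatching {V : Type*} (G : SimpleGraph V) : Prop :=
  G.edgeSet.Pairwise fun e f => ∀ v : V, v ∈ e → v ∉ f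

/-- Every vertex has degree at most `d`. -/
def HasMaxDegreeLE {V : Type*} (G : SimpleGraph V) (d : ℕ) : Prop :=
  ∀ x : V, (G.neighborSet x).encard ≤ d

/-- The vertices that lie in infinite connectivity components of `G`. -/
def infiniteComponentVerts {V : Type*} (G : SimpleGraph V) : Set V :=
  {x | (G.connectedComponentMk x).supp.Infinite}

/-- `(V, E, μ)` is a graphing, where `E` is the edge relation of `G`: the vertex space is standard
Borel, `E` is Borel, `μ` is a probability measure, and `E` is generated by finitely many invertible
measure-preserving Borel maps `φ i : A i → B i` between Borel subsets of `V`. -/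
structure IsGraphing {V : Type*} [MeasurableSpace V] (G : SimpleGraph V) (μ : Measure V) :
    Prop where
  standardBorel : StandardBorelSpace V
  isProbabilityMeasure : IsProbabilityMeasure μ
  isBorelGraph : IsBorelGraph G
  generated : ∃ (n : ℕ) (A B : Fin n → Set V) (φ : ∀ i, A i ≃ᵐ B i),
    (∀ i, MeasurableSet (A i)) ∧ (∀ i, MeasurableSet (B i)) ∧
    (∀ i, MeasurePreserving (φ i) (μ.comap Subtype.val) (μ.comap Subtype.val)) ∧
    ∀ x y : V, G.Adj x y ↔ x ≠ y ∧ ∃ i,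
      (∃ h : x ∈ A i, (φ i ⟨x, h⟩ : V) = y) ∨ (∃ h : y ∈ A i, (φ i ⟨y, h⟩ : V) = x)

/-! It suffices to find a Borel set `M` of edges, pairwise at `G`-distance greater than one, that
meets almost every infinite component of every `F j`. A component of `F 0 ⊔ M` then has at most four
vertices: an edge of `M` and the `F 0`-partners of its ends
(`IsEdgeMatching.infiniteComponentVerts_sup_eq_empty`). An infinite component of `F j \ M` either is
a whole component of `F j` missed by `M`, or has a vertex of degree at most one. In the second case
it is a ray, and rays form a null set (`measure_rayVerts`): their endpoints occur once per infinite
component, and moving them to distances 0, 1, ..., r gives disjoint sets of equal measure.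

To build `M` (`exists_separated_edges`), the types of edges (index `j`, map `h l`, colour class) are
treated in a sequence where each type recurs infinitely often. Stage `t` proposes edges starting in
a set `W t` that meets every relevant component but is as small as desired (`exists_small_subset`).
Proposals within distance 3 of a later one are discarded. Later stages are so small that at stage
`t` all but measure `2⁻¹ ^ t` of the relevant vertices keep an edge in their component
(`exists_measure_absorbed_le`); recurrence makes the missed set null. -/

/-- The edges of `G` are traced out by the finitely many measure-preserving Borel injections
`g i`, restricted to the Borel sets `D i`. -/
structure IsTracedBy {V : Type*} [MeasurableSpace V] (G : SimpleGraph V) (μ : Measure V)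
    {ι : Type*} (D : ι → Set V) (g : ι → V → V) : Prop where
  measurableSet_dom : ∀ i, MeasurableSet (D i)
  measurable_map : ∀ i, Measurable (g i)
  injOn : ∀ i, Set.InjOn (g i) (D i)
  measure_image : ∀ i X, MeasurableSet X → X ⊆ D i → μ (g i '' X) = μ X
  exists_of_adj : ∀ x y, G.Adj x y → ∃ i, x ∈ D i ∧ g i x = y

/-- A sequence of measure-preserving Borel injections `h l`, restricted to the Borel sets `D l`,
such that finitely many of them reach everything within a given distance in `G`. -/
structure IsExhaustedBy {V : Type*} [MeasurableSpace V] (G : SimpleGraph V) (μ : Measure V)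
    (D : ℕ → Set V) (h : ℕ → V → V) : Prop where
  measurableSet_dom : ∀ l, MeasurableSet (D l)
  measurable_map : ∀ l, Measurable (h l)
  injOn : ∀ l, Set.InjOn (h l) (D l)
  measure_image : ∀ l X, MeasurableSet X → X ⊆ D l → μ (h l '' X) = μ X
  exists_bound : ∀ d : ℕ, ∃ N : ℕ, ∀ x y, G.edist x y ≤ d → ∃ l < N, x ∈ D l ∧ h l x = y

/-! ### Total maps from the partial bijections. -/

section Extension

variable {V : Type*} {A B : Set V}

open Classical in
/-- Extension of a map between subsets of `V` by the identity. -/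
noncomputable def extendById (φ : A → B) (x : V) : V :=
  if h : x ∈ A then φ ⟨x, h⟩ else x

lemma extendById_of_mem (φ : A → B) {x : V} (hx : x ∈ A) : extendById φ x = φ ⟨x, hx⟩ := by
  simp [extendById, hx]

lemma injOn_extendById {φ : A → B} (hφ : Function.Injective φ) :
    Set.InjOn (extendById φ) A := by
  intro x hx y hy hxy
  rw [extendById_of_mem φ hx, extendById_of_mem φ hy] at hxy
  simpa using hφ (Subtype.ext hxy)

variable [MeasurableSpace V] {μ : Measure V}

lemma measurable_extendById (hA : MeasurableSet A) {φ : A → B} (hφ : Measurable φ) :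
    Measurable (extendById φ) := by
  classical
  unfold extendById
  exact Measurable.dite (measurable_subtype_coe.comp hφ) measurable_subtype_coe hA

lemma measure_image_extendById (hA : MeasurableSet A) (hB : MeasurableSet B) (φ : A ≃ᵐ B)
    (hφ : MeasurePreserving φ (μ.comap Subtype.val) (μ.comap Subtype.val)) {X : Set V}
    (hXA : X ⊆ A) : μ (extendById φ '' X) = μ X := by
  have h1 : extendById φ '' X = Subtype.val '' (φ.symm ⁻¹' (Subtype.val ⁻¹' X)) := by
    ext y
    constructor
    · rintro ⟨x, hx, rfl⟩
      exact ⟨φ ⟨x, hXA hx⟩, by simpa using hx, (extendById_of_mem φ (hXA hx)).symm⟩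
    · rintro ⟨z, hz, rfl⟩
      refine ⟨φ.symm z, hz, ?_⟩
      rw [extendById_of_mem φ (φ.symm z).2]
      simp
  rw [h1, ← comap_subtype_coe_apply hB, (hφ.symm φ).measure_preimage_equiv,
    comap_subtype_coe_apply hA, Subtype.image_preimage_coe, Set.inter_eq_right.2 hXA]

end Extension

/-- The inverse maps are included because every edge must be traced in both directions. -/
lemma IsGraphing.exists_isTracedBy {V : Type*} [MeasurableSpace V] {G : SimpleGraph V}
    {μ : Measure V} (hG : IsGraphing G μ) :
    ∃ (ι : Type) (_ : Finite ι) (D : ι → Set V) (g : ι → V → V), IsTracedBy G μ D g := by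
  obtain ⟨n, A, B, φ, hA, hB, hφ, hadj⟩ := hG.generated
  refine ⟨Fin n ⊕ Fin n, inferInstance, Sum.elim A B,
    Sum.elim (fun i => extendById (φ i)) (fun i => extendById (φ i).symm), ?_, ?_, ?_, ?_, ?_⟩
  · rintro (i | i)
    exacts [hA i, hB i]
  · rintro (i | i)
    exacts [measurable_extendById (hA i) (φ i).measurable,
      measurable_extendById (hB i) (φ i).symm.measurable]
  · rintro (i | i)
    exacts [injOn_extendById (φ i).injective, injOn_extendById (φ i).symm.injective]
  · rintro (i | i) X - hX
    exacts [measure_image_extendById (hA i) (hB i) (φ i) (hφ i) hX,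
      measure_image_extendById (hB i) (hA i) (φ i).symm ((hφ i).symm (φ i)) hX]
  · intro x y hxy
    obtain ⟨-, i, ⟨h, e⟩ | ⟨h, e⟩⟩ := (hadj x y).1 hxy
    · exact ⟨.inl i, h, by simpa [extendById_of_mem _ h] using e⟩
    · subst e
      refine ⟨.inr i, (φ i ⟨y, h⟩).2, ?_⟩
      simp only [Sum.elim_inr]
      rw [extendById_of_mem _ (φ i ⟨y, h⟩).2]
      simp

/-! ### Words in the generators. -/

section Words

variable {V ι : Type*}

/-- The composition of the maps `g i` along a word. -/
def wordMap (g : ι → V → V) : List ι → V → V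
  | [] => id
  | i :: l => wordMap g l ∘ g i

/-- The domain of `wordMap g l` when each `g i` is restricted to `D i`. -/
def wordDom (D : ι → Set V) (g : ι → V → V) : List ι → Set V
  | [] => Set.univ
  | i :: l => D i ∩ g i ⁻¹' wordDom D g l

variable [MeasurableSpace V] {G : SimpleGraph V} {μ : Measure V} {D : ι → Set V} {g : ι → V → V}

lemma IsTracedBy.measurable_wordMap (H : IsTracedBy G μ D g) :
    ∀ l, Measurable (wordMap g l)
  | [] => measurable_id
  | i :: l => (H.measurable_wordMap l).comp (H.measurable_map i)

lemma IsTracedBy.measurableSet_wordDom (H : IsTracedBy G μ D g) :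
    ∀ l, MeasurableSet (wordDom D g l)
  | [] => MeasurableSet.univ
  | i :: l => (H.measurableSet_dom i).inter (H.measurable_map i (H.measurableSet_wordDom l))

lemma IsTracedBy.injOn_wordMap (H : IsTracedBy G μ D g) :
    ∀ l, Set.InjOn (wordMap g l) (wordDom D g l)
  | [] => Set.injOn_id _
  | i :: l => (H.injOn_wordMap l).comp ((H.injOn i).mono Set.inter_subset_left)
      (fun _ hx => hx.2)

lemma IsTracedBy.measure_image_wordMap [StandardBorelSpace V] (H : IsTracedBy G μ D g) :
    ∀ l X, MeasurableSet X → X ⊆ wordDom D g l → μ (wordMap g l '' X) = μ X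
  | [], X, _, _ => by simp [wordMap]
  | i :: l, X, hX, hXl => by
      have hXi : X ⊆ D i := fun x hx => (hXl hx).1
      have him : MeasurableSet (g i '' X) :=
        hX.image_of_measurable_injOn (H.measurable_map i) ((H.injOn i).mono hXi)
      rw [wordMap, Set.image_comp, H.measure_image_wordMap l _ him, H.measure_image i X hX hXi]
      rintro _ ⟨x, hx, rfl⟩
      exact (hXl hx).2

lemma IsTracedBy.exists_word_of_walk (H : IsTracedBy G μ D g) {x y : V} (p : G.Walk x y) :
    ∃ l : List ι, l.length = p.length ∧ x ∈ wordDom D g l ∧ wordMap g l x = y := by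
  induction p with
  | nil => exact ⟨[], rfl, trivial, rfl⟩
  | cons hadj p ih =>
    obtain ⟨l, hl, hx, e⟩ := ih
    obtain ⟨i, hi, rfl⟩ := H.exists_of_adj _ _ hadj
    exact ⟨i :: l, by simp [hl], ⟨hi, hx⟩, e⟩

end Words

lemma SimpleGraph.exists_walk_length_le_of_edist_le {V : Type*} {G : SimpleGraph V} {x y : V}
    {d : ℕ} (h : G.edist x y ≤ d) : ∃ p : G.Walk x y, p.length ≤ d := by
  have hne : G.edist x y ≠ ⊤ := ne_top_of_le_ne_top (ENat.natCast_ne_top d) h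
  obtain ⟨p, hp⟩ := G.exists_walk_of_edist_ne_top hne
  exact ⟨p, by rw [← hp] at h; exact_mod_cast h⟩

/-- The maps are all words in the generators. Words of length at most `d` reach the ball of radius
`d`, and there are finitely many of them. -/
lemma IsGraphing.exists_isExhaustedBy {V : Type*} [MeasurableSpace V] {G : SimpleGraph V}
    {μ : Measure V} (hG : IsGraphing G μ) :
    ∃ (D : ℕ → Set V) (h : ℕ → V → V), IsExhaustedBy G μ D h := by
  have := hG.standardBorel
  obtain ⟨ι, _, D, g, H⟩ := hG.exists_isTracedBy
  obtain ⟨w, hw⟩ := exists_surjective_nat (List ι)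
  refine ⟨fun l => wordDom D g (w l), fun l => wordMap g (w l), fun l => H.measurableSet_wordDom _,
    fun l => H.measurable_wordMap _, fun l => H.injOn_wordMap _,
    fun l => H.measure_image_wordMap _, fun d => ?_⟩
  choose c hc using hw
  obtain ⟨N, hN⟩ := ((List.finite_length_le ι d).image c).bddAbove
  refine ⟨N + 1, fun x y hxy => ?_⟩
  obtain ⟨p, hp⟩ := SimpleGraph.exists_walk_length_le_of_edist_le hxy
  obtain ⟨l, hl, hx, e⟩ := H.exists_word_of_walk p
  refine ⟨c l, Nat.lt_succ_of_le (hN ⟨l, ?_, rfl⟩), ?_⟩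
  · simp only [Set.mem_ofPred_eq]
    omega
  · simp only [hc]
    exact ⟨hx, e⟩

/-! ### Borel sets defined by distances, and separated Borel sets. -/

namespace IsExhaustedBy

variable {V : Type*} [MeasurableSpace V] {G F : SimpleGraph V} {μ : Measure V}
  {D : ℕ → Set V} {h : ℕ → V → V}

lemma exists_of_edist_le (H : IsExhaustedBy G μ D h) (hFG : F ≤ G) {x y : V} {d : ℕ}
    (hxy : F.edist x y ≤ d) : ∃ l, x ∈ D l ∧ h l x = y := by
  obtain ⟨N, hN⟩ := H.exists_bound d
  obtain ⟨l, -, hl⟩ := hN x y ((SimpleGraph.edist_anti hFG).trans hxy)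
  exact ⟨l, hl⟩

lemma exists_of_adj (H : IsExhaustedBy G μ D h) (hFG : F ≤ G) {x y : V}
    (hxy : F.Adj x y) : ∃ l, x ∈ D l ∧ h l x = y :=
  H.exists_of_edist_le hFG (d := 1) (SimpleGraph.edist_le_one_iff_adj_or_eq.2 (.inl hxy))

lemma exists_of_reachable (H : IsExhaustedBy G μ D h) (hFG : F ≤ G) {x y : V}
    (hxy : F.Reachable x y) : ∃ l, x ∈ D l ∧ h l x = y :=
  let ⟨p⟩ := hxy
  H.exists_of_edist_le hFG p.edist_le

lemma finite_setOf_edist_le (H : IsExhaustedBy G μ D h) (hFG : F ≤ G) (x : V) (d : ℕ) :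
    {y | F.edist x y ≤ d}.Finite := by
  obtain ⟨N, hN⟩ := H.exists_bound d
  refine ((Set.finite_Iio N).image fun l => h l x).subset fun y hy => ?_
  obtain ⟨l, hl, -, e⟩ := hN x y ((SimpleGraph.edist_anti hFG).trans hy)
  exact ⟨l, hl, e⟩

lemma measure_preimage_le (H : IsExhaustedBy G μ D h) (l : ℕ) {Y : Set V}
    (hY : MeasurableSet Y) : μ (D l ∩ h l ⁻¹' Y) ≤ μ Y := by
  rw [← H.measure_image l _ ((H.measurableSet_dom l).inter (H.measurable_map l hY))
    Set.inter_subset_left]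
  exact measure_mono (by rintro _ ⟨x, hx, rfl⟩; exact hx.2)

/-- A set of vertices all of whose components meet a given null set is null. -/
lemma measure_eq_zero_of_reachable (H : IsExhaustedBy G μ D h) (hFG : F ≤ G) {Y Z : Set V}
    (hY : MeasurableSet Y) (hY0 : μ Y = 0) (hZ : ∀ x ∈ Z, ∃ y ∈ Y, F.Reachable x y) :
    μ Z = 0 := by
  refine measure_mono_null (t := ⋃ l, D l ∩ h l ⁻¹' Y) (fun x hx => ?_)
    (measure_iUnion_null fun l => le_antisymm ((H.measure_preimage_le l hY).trans hY0.le) zero_le)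
  obtain ⟨y, hy, hxy⟩ := hZ x hx
  obtain ⟨l, hl, rfl⟩ := H.exists_of_reachable hFG hxy
  exact Set.mem_iUnion.2 ⟨l, hl, hy⟩

variable [StandardBorelSpace V]

/-- Splitting off the first edge of a walk gives an induction on `n`; the quantifier over neighbours
becomes a countable union over `l`. -/
lemma measurableSet_edist_le (H : IsExhaustedBy G μ D h) (hFG : F ≤ G) (hF : IsBorelGraph F)
    (n : ℕ) : MeasurableSet {p : V × V | F.edist p.1 p.2 ≤ n} := by
  induction n with
  | zero =>
    have : {p : V × V | F.edist p.1 p.2 ≤ (0 : ℕ)} = {p | p.1 = p.2} := by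
      ext p
      simp
    rw [this]
    exact measurableSet_eq_fun measurable_fst measurable_snd
  | succ n ih =>
    have : {p : V × V | F.edist p.1 p.2 ≤ (n + 1 : ℕ)} = {p | F.edist p.1 p.2 ≤ n} ∪
        ⋃ l, ((fun p : V × V => (p.1, h l p.1)) ⁻¹' {p | F.Adj p.1 p.2}) ∩
          ((fun p : V × V => (h l p.1, p.2)) ⁻¹' {p | F.edist p.1 p.2 ≤ n}) := by
      ext ⟨x, y⟩
      simp only [Set.mem_ofPred_eq, Set.mem_union, Set.mem_iUnion, Set.mem_inter_iff,
        Set.mem_preimage]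
      constructor
      · intro hxy
        obtain ⟨p, hp⟩ := SimpleGraph.exists_walk_length_le_of_edist_le hxy
        cases p with
        | nil => simp
        | cons hadj p =>
          obtain ⟨l, -, rfl⟩ := H.exists_of_adj hFG hadj
          refine .inr ⟨l, hadj, p.edist_le.trans ?_⟩
          simp only [SimpleGraph.Walk.length_cons] at hp
          exact_mod_cast (by omega : p.length ≤ n)
      · rintro (hxy | ⟨l, hadj, hxy⟩)
        · exact hxy.trans (by exact_mod_cast n.le_succ)
        · refine (SimpleGraph.edist_triangle (v := h l x)).trans ?_
          rw [SimpleGraph.edist_eq_one_iff_adj.2 hadj, add_comm]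
          push_cast
          gcongr
    rw [this]
    refine ih.union (.iUnion fun l => .inter ?_ ?_)
    · exact (measurable_fst.prodMk ((H.measurable_map l).comp measurable_fst)) hF
    · exact (((H.measurable_map l).comp measurable_fst).prodMk measurable_snd) ih

lemma measurableSet_map_edist_le (H : IsExhaustedBy G μ D h) (hFG : F ≤ G)
    (hF : IsBorelGraph F) (l n : ℕ) : MeasurableSet {x | F.edist x (h l x) ≤ n} :=
  (measurable_id.prodMk (H.measurable_map l)) (H.measurableSet_edist_le hFG hF n)

lemma measurableSet_map_edist_eq (H : IsExhaustedBy G μ D h) (hFG : F ≤ G)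
    (hF : IsBorelGraph F) (l n : ℕ) : MeasurableSet {x | F.edist x (h l x) = n} := by
  have : {x | F.edist x (h l x) = n} =
      {x | F.edist x (h l x) ≤ n} \ ⋃ m ∈ Set.Iio n, {x | F.edist x (h l x) ≤ m} := by
    ext x
    simp only [Set.mem_ofPred_eq, Set.mem_sdiff, Set.mem_iUnion, not_exists, Set.mem_Iio]
    constructor
    · intro e
      rw [e]
      exact ⟨le_rfl, fun m hm hnm => absurd (by exact_mod_cast hnm) (not_le.2 hm)⟩
    · rintro ⟨h1, h2⟩
      obtain ⟨m, hm⟩ := ENat.ne_top_iff_exists.1 (ne_top_of_le_ne_top (ENat.natCast_ne_top n) h1)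
      rw [← hm] at h1 h2 ⊢
      have h3 : m ≤ n := by exact_mod_cast h1
      rcases h3.eq_or_lt with rfl | h3
      · rfl
      · exact absurd le_rfl (h2 m h3)
  rw [this]
  exact (H.measurableSet_map_edist_le hFG hF l n).diff
    (.biUnion (Set.to_countable _) fun m _ => H.measurableSet_map_edist_le hFG hF l m)

lemma measurableSet_map_reachable (H : IsExhaustedBy G μ D h) (hFG : F ≤ G)
    (hF : IsBorelGraph F) (l : ℕ) : MeasurableSet {x | F.Reachable x (h l x)} := by
  have : {x | F.Reachable x (h l x)} = ⋃ n : ℕ, {x | F.edist x (h l x) ≤ n} := by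
    ext x
    simp only [Set.mem_ofPred_eq, Set.mem_iUnion]
    exact ⟨fun ⟨p⟩ => ⟨p.length, p.edist_le⟩, fun ⟨n, hn⟩ =>
      SimpleGraph.reachable_of_edist_ne_top (ne_top_of_le_ne_top (ENat.natCast_ne_top n) hn)⟩
  rw [this]
  exact .iUnion fun n => H.measurableSet_map_edist_le hFG hF l n

lemma measurableSet_near (H : IsExhaustedBy G μ D h) (hFG : F ≤ G) (hF : IsBorelGraph F)
    (n : ℕ) {Y : Set V} (hY : MeasurableSet Y) :
    MeasurableSet {x | ∃ y ∈ Y, F.edist x y ≤ n} := by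
  have : {x | ∃ y ∈ Y, F.edist x y ≤ n} =
      ⋃ l, D l ∩ (h l ⁻¹' Y ∩ {x | F.edist x (h l x) ≤ n}) := by
    ext x
    simp only [Set.mem_ofPred_eq, Set.mem_iUnion, Set.mem_inter_iff, Set.mem_preimage]
    constructor
    · rintro ⟨y, hy, hxy⟩
      obtain ⟨l, hl, rfl⟩ := H.exists_of_edist_le hFG hxy
      exact ⟨l, hl, hy, hxy⟩
    · rintro ⟨l, -, hy, hxy⟩
      exact ⟨_, hy, hxy⟩
  rw [this]
  exact .iUnion fun l => (H.measurableSet_dom l).inter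
    ((H.measurable_map l hY).inter (H.measurableSet_map_edist_le hFG hF l n))

/-- A countable Borel colouring: identify `V` with a subset of the reals, and let colour `c` consist
of the points of the `c`-th rational interval with no other point of that interval within distance
`r`. -/
lemma exists_cover_separated (H : IsExhaustedBy G μ D h) (hFG : F ≤ G) (hF : IsBorelGraph F)
    (r : ℕ) : ∃ U : ℕ → Set V, (∀ c, MeasurableSet (U c)) ∧ (∀ x, ∃ c, x ∈ U c) ∧
      ∀ c, (U c).Pairwise fun x y => (r : ℕ∞) < F.edist x y := by
  have he := measurableEmbedding_embeddingReal V
  set e := embeddingReal V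
  obtain ⟨q, hq⟩ := exists_surjective_nat (ℚ × ℚ)
  let I : ℕ → Set V := fun c => e ⁻¹' Set.Ioo ((q c).1 : ℝ) (q c).2
  have hI : ∀ c, MeasurableSet (I c) := fun c => he.measurable measurableSet_Ioo
  refine ⟨fun c => I c \ ⋃ l, D l ∩ ({x | F.edist x (h l x) ≤ r} ∩ (h l ⁻¹' I c ∩
    {x | h l x = x}ᶜ)), fun c => (hI c).diff (.iUnion fun l => (H.measurableSet_dom l).inter
      ((H.measurableSet_map_edist_le hFG hF l r).inter ((H.measurable_map l (hI c)).inter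
        (measurableSet_eq_fun (H.measurable_map l) measurable_id).compl))), fun x => ?_,
    fun c x hx y hy hxy => ?_⟩
  -- Balls are finite, so some rational interval isolates `x` from the rest of its ball.
  · have hfin := ((H.finite_setOf_edist_le hFG x r).sdiff (t := {x})).image e
    have hmem : e x ∈ (e '' ({y | F.edist x y ≤ r} \ {x}))ᶜ := by
      rintro ⟨y, hy, hyx⟩
      exact hy.2 (he.injective hyx)
    obtain ⟨a, b, hx, hab⟩ :=
      mem_nhds_iff_exists_Ioo_subset.1 (hfin.isClosed.isOpen_compl.mem_nhds hmem)
    obtain ⟨a', ha, ha'⟩ := exists_rat_btwn hx.1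
    obtain ⟨b', hb, hb'⟩ := exists_rat_btwn hx.2
    obtain ⟨c, hc⟩ := hq (a', b')
    refine ⟨c, ⟨?_, ?_⟩⟩
    · simp only [I, hc]
      exact ⟨ha', hb⟩
    · simp only [Set.mem_iUnion, not_exists]
      rintro l ⟨-, hr, hl, hne⟩
      simp only [I, hc] at hl
      exact hab ⟨ha.trans hl.1, hl.2.trans hb'⟩ ⟨h l x, ⟨hr, hne⟩, rfl⟩
  · by_contra! hle
    obtain ⟨l, hl, rfl⟩ := H.exists_of_edist_le hFG hle
    exact hx.2 (Set.mem_iUnion.2 ⟨l, hl, hle, hy.1, fun e => hxy e.symm⟩)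

/-- Greedy choice along the colours: within one colour all points are already far apart, so all
those not near earlier choices can be added at once. -/
lemma exists_maximal_separated (H : IsExhaustedBy G μ D h) (hFG : F ≤ G) (hF : IsBorelGraph F)
    (r : ℕ) {W : Set V} (hW : MeasurableSet W) : ∃ Y ⊆ W, MeasurableSet Y ∧
      (Y.Pairwise fun x y => (r : ℕ∞) < F.edist x y) ∧ ∀ x ∈ W, ∃ y ∈ Y, F.edist x y ≤ r := by
  obtain ⟨U, hU, hcov, hsep⟩ := H.exists_cover_separated hFG hF r
  let A : ℕ → Set V := fun n =>
    n.rec ∅ fun c s => s ∪ ((W ∩ U c) \ {x | ∃ y ∈ s, F.edist x y ≤ r})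
  have hA : ∀ c, A (c + 1) = A c ∪ ((W ∩ U c) \ {x | ∃ y ∈ A c, F.edist x y ≤ r}) :=
    fun _ => rfl
  have hmono : Monotone A := monotone_nat_of_le_succ fun c => by
    rw [hA]
    exact Set.subset_union_left
  have hmeas : ∀ c, MeasurableSet (A c) := by
    intro c
    induction c with
    | zero => exact MeasurableSet.empty
    | succ c ih => exact ih.union ((hW.inter (hU c)).diff (H.measurableSet_near hFG hF r ih))
  have hAsep : ∀ c, (A c).Pairwise fun x y => (r : ℕ∞) < F.edist x y := by
    intro c
    induction c with
    | zero => exact Set.pairwise_empty _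
    | succ c ih =>
      rw [hA]
      have : Std.Symm fun x y => (r : ℕ∞) < F.edist x y :=
        ⟨fun x y hxy => by rwa [SimpleGraph.edist_comm]⟩
      refine Set.pairwise_union_of_symm.2 ⟨ih, (hsep c).mono fun x hx => hx.1.2, ?_⟩
      intro x hx y hy _
      by_contra! hle
      exact hy.2 ⟨x, hx, by rwa [SimpleGraph.edist_comm]⟩
  refine ⟨⋃ c, A c, Set.iUnion_subset fun c => ?_, .iUnion hmeas,
    (Set.pairwise_iUnion hmono.directed_le).2 hAsep, fun x hx => ?_⟩
  · induction c with
    | zero => exact Set.empty_subset _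
    | succ c ih => exact Set.union_subset ih fun x hx => hx.1.1
  · obtain ⟨c, hc⟩ := hcov x
    rcases em (∃ y ∈ A c, F.edist x y ≤ r) with ⟨y, hy, hxy⟩ | hnear
    · exact ⟨y, Set.mem_iUnion.2 ⟨c, hy⟩, hxy⟩
    · exact ⟨x, Set.mem_iUnion.2 ⟨c + 1, .inr ⟨⟨hx, hc⟩, hnear⟩⟩, by simp⟩

end IsExhaustedBy

/-! ### Measure estimates for infinite components. -/

/-- The vertices that have vertices at every finite distance. -/
def farReachingVerts {V : Type*} (F : SimpleGraph V) : Set V :=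
  {x | ∀ d : ℕ, ∃ y, F.edist x y = d}

namespace IsExhaustedBy

variable {V : Type*} [MeasurableSpace V] {G F : SimpleGraph V} {μ : Measure V}
  {D : ℕ → Set V} {h : ℕ → V → V}

/-- Balls are finite, so an infinite component contains arbitrarily distant vertices, and geodesics
to them pass through every distance. This gives a Borel description of lying in an infinite
component. -/
lemma infiniteComponentVerts_subset (H : IsExhaustedBy G μ D h) (hFG : F ≤ G) :
    infiniteComponentVerts F ⊆ farReachingVerts F := by
  intro x hx d
  obtain ⟨y, hy, hyd⟩ := hx.exists_notMem_finite (H.finite_setOf_edist_le hFG x d)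
  simp only [SimpleGraph.ConnectedComponent.mem_supp_iff, SimpleGraph.ConnectedComponent.eq] at hy
  obtain ⟨p, hp⟩ := hy.symm.exists_walk_length_eq_edist
  simp only [Set.mem_ofPred_eq, not_le, ← hp] at hyd
  have hd : d < p.length := by exact_mod_cast hyd
  refine ⟨p.getVert d, le_antisymm ?_ ?_⟩
  · have := (p.take d).edist_le
    rwa [SimpleGraph.Walk.take_length, min_eq_left hd.le] at this
  · have h1 := SimpleGraph.edist_triangle (G := F) (u := x) (v := p.getVert d) (w := y)
    have h2 := (p.drop d).edist_le
    rw [SimpleGraph.Walk.drop_length] at h2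
    rw [← hp] at h1
    by_contra! hlt
    obtain ⟨m, hm⟩ := ENat.ne_top_iff_exists.1 (ne_top_of_lt hlt)
    rw [← hm] at h1 hlt
    have h3 : (p.length : ℕ∞) ≤ (m + (p.length - d) : ℕ) := by
      push_cast
      exact h1.trans (by gcongr; exact_mod_cast h2)
    have h4 : p.length ≤ m + (p.length - d) := by exact_mod_cast h3
    have h5 : m < d := by exact_mod_cast hlt
    omega

lemma exists_measure_near_le (H : IsExhaustedBy G μ D h) (d : ℕ) : ∃ N : ℕ,
    ∀ Z : Set V, MeasurableSet Z → μ {x | ∃ z ∈ Z, G.edist x z ≤ d} ≤ N * μ Z := by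
  obtain ⟨N, hN⟩ := H.exists_bound d
  refine ⟨N, fun Z hZ => ?_⟩
  calc μ {x | ∃ z ∈ Z, G.edist x z ≤ d} ≤ μ (⋃ l ∈ Finset.range N, D l ∩ h l ⁻¹' Z) := by
        refine measure_mono ?_
        rintro x ⟨z, hz, hxz⟩
        obtain ⟨l, hlN, hl, rfl⟩ := hN x z hxz
        exact Set.mem_biUnion (Finset.mem_coe.2 (Finset.mem_range.2 hlN)) ⟨hl, hz⟩
    _ ≤ ∑ l ∈ Finset.range N, μ (D l ∩ h l ⁻¹' Z) := measure_biUnion_finset_le _ _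
    _ ≤ ∑ _l ∈ Finset.range N, μ Z :=
        Finset.sum_le_sum fun l _ => H.measure_preimage_le l hZ
    _ = N * μ Z := by simp

variable [StandardBorelSpace V]

lemma measurableSet_farReachingVerts (H : IsExhaustedBy G μ D h) (hFG : F ≤ G)
    (hF : IsBorelGraph F) : MeasurableSet (farReachingVerts F) := by
  have : farReachingVerts F = ⋂ d : ℕ, ⋃ l, D l ∩ {x | F.edist x (h l x) = d} := by
    ext x
    simp only [farReachingVerts, Set.mem_ofPred_eq, Set.mem_iInter, Set.mem_iUnion,
      Set.mem_inter_iff]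
    refine forall_congr' fun d => ⟨?_, fun ⟨l, _, e⟩ => ⟨_, e⟩⟩
    rintro ⟨y, e⟩
    obtain ⟨l, hl, rfl⟩ := H.exists_of_edist_le hFG e.le
    exact ⟨l, hl, e⟩
  rw [this]
  exact .iInter fun d => .iUnion fun l => (H.measurableSet_dom l).inter
    (H.measurableSet_map_edist_eq hFG hF l d)

/-- A set whose points are far from each other, all of them having vertices at every distance,
has small measure. -/
lemma mul_measure_le_of_separated (H : IsExhaustedBy G μ D h) (hFG : F ≤ G)
    (hF : IsBorelGraph F) (r : ℕ) {Y : Set V} (hY : MeasurableSet Y)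
    (hfar : Y ⊆ farReachingVerts F)
    (hsep : Y.Pairwise fun x y => ((2 * r : ℕ) : ℕ∞) < F.edist x y) :
    μ Y * (r + 1) ≤ μ Set.univ := by
  let S : ℕ → ℕ → Set V := fun d l => D l ∩ {x | F.edist x (h l x) = d}
  have hS : ∀ d l, MeasurableSet (S d l) := fun d l =>
    (H.measurableSet_dom l).inter (H.measurableSet_map_edist_eq hFG hF l d)
  -- Each point of `Y` is sent to distance `d` by the first `l` that does so.
  let X : ℕ → ℕ → Set V := fun d l => Y ∩ disjointed (S d) l
  have hX : ∀ d l, MeasurableSet (X d l) := fun d l => hY.inter (.disjointed (hS d) l)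
  have hXS : ∀ d l, X d l ⊆ S d l := fun d l x hx => disjointed_subset (S d) l hx.2
  have hXD : ∀ d l, X d l ⊆ D l := fun d l x hx => (hXS d l hx).1
  have hXY : ∀ d, ⋃ l, X d l = Y := by
    intro d
    rw [← Set.inter_iUnion, iUnion_disjointed, Set.inter_eq_left]
    intro x hx
    obtain ⟨y, e⟩ := hfar hx d
    obtain ⟨l, hl, rfl⟩ := H.exists_of_edist_le hFG e.le
    exact Set.mem_iUnion.2 ⟨l, hl, e⟩
  have hXdisj : ∀ d, Pairwise (Function.onFun Disjoint (X d)) := fun d l l' hl =>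
    (disjoint_disjointed (S d) hl).mono Set.inter_subset_right Set.inter_subset_right
  -- A common image of two points would put them within `2 * r`; a single point has different images
  -- for different `d`.
  have himdisj : Pairwise (Function.onFun Disjoint
      fun p : Fin (r + 1) × ℕ => h p.2 '' X p.1 p.2) := by
    rintro ⟨d, l⟩ ⟨d', l'⟩ hne
    refine Set.disjoint_left.2 ?_
    rintro _ ⟨x, hx, rfl⟩ ⟨x', hx', e⟩
    have h1 : F.edist x (h l x) = d := (hXS _ _ hx).2
    have h2 : F.edist x' (h l' x') = d' := (hXS _ _ hx').2
    simp only at e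
    have hxx : x = x' := by
      by_contra hxx
      refine (hsep hx.1 hx'.1 hxx).not_ge ((SimpleGraph.edist_triangle (v := h l x)).trans ?_)
      rw [h1, ← e, SimpleGraph.edist_comm, h2]
      have := d.2
      have := d'.2
      exact_mod_cast (by omega : (d : ℕ) + d' ≤ 2 * r)
    subst hxx
    have hdd : d = d' := by
      rw [e, h1] at h2
      exact Fin.ext (by exact_mod_cast h2)
    subst hdd
    by_cases hll : l = l'
    · exact hne (by rw [hll])
    · exact Set.disjoint_left.1 (hXdisj d hll) hx hx'
  calc μ Y * (r + 1) = ∑' d : Fin (r + 1), ∑' l, μ (X d l) := by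
        have : ∀ d : Fin (r + 1), ∑' l, μ (X d l) = μ Y := fun d => by
          rw [← measure_iUnion (hXdisj d) (hX d), hXY]
        simp [this, tsum_fintype, mul_comm]
    _ = ∑' p : Fin (r + 1) × ℕ, μ (X p.1 p.2) :=
        (ENNReal.tsum_prod (f := fun (d : Fin (r + 1)) l => μ (X d l))).symm
    _ = ∑' p : Fin (r + 1) × ℕ, μ (h p.2 '' X p.1 p.2) :=
        tsum_congr fun p => (H.measure_image _ _ (hX _ _) (hXD _ _)).symm
    _ = μ (⋃ p : Fin (r + 1) × ℕ, h p.2 '' X p.1 p.2) :=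
        (measure_iUnion himdisj fun p => (hX _ _).image_of_measurable_injOn
          (H.measurable_map _) ((H.injOn _).mono (hXD _ _))).symm
    _ ≤ μ Set.univ := measure_mono (Set.subset_univ _)

variable [IsProbabilityMeasure μ]

lemma measure_le_inv_of_separated (H : IsExhaustedBy G μ D h) (hFG : F ≤ G)
    (hF : IsBorelGraph F) (r : ℕ) {Y : Set V} (hY : MeasurableSet Y)
    (hfar : Y ⊆ farReachingVerts F)
    (hsep : Y.Pairwise fun x y => ((2 * r : ℕ) : ℕ∞) < F.edist x y) :
    μ Y ≤ (r : ENNReal)⁻¹ := by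
  rw [ENNReal.le_inv_iff_mul_le]
  calc μ Y * r ≤ μ Y * (r + 1) := by gcongr; exact le_self_add
    _ ≤ μ Set.univ := H.mul_measure_le_of_separated hFG hF r hY hfar hsep
    _ = 1 := measure_univ

/-- A set with at most one point in each component, all of them in infinite components, is null. -/
lemma measure_eq_zero_of_not_reachable (H : IsExhaustedBy G μ D h) (hFG : F ≤ G)
    (hF : IsBorelGraph F) {Y : Set V} (hY : MeasurableSet Y) (hfar : Y ⊆ farReachingVerts F)
    (hsep : Y.Pairwise fun x y => ¬ F.Reachable x y) : μ Y = 0 := by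
  by_contra hne
  obtain ⟨r, hr⟩ := ENNReal.exists_inv_nat_lt hne
  refine hr.not_ge (H.measure_le_inv_of_separated hFG hF r hY hfar fun x hx y hy hxy => ?_)
  simp only [SimpleGraph.edist_eq_top_of_not_reachable (hsep hx hy hxy)]
  exact ENat.natCast_lt_top _

/-- Inside a set of vertices of infinite components there is a set of small measure that meets the
same components. -/
lemma exists_small_subset (H : IsExhaustedBy G μ D h) (hFG : F ≤ G) (hF : IsBorelGraph F)
    {W : Set V} (hW : MeasurableSet W) (hfar : W ⊆ farReachingVerts F) {ε : ENNReal}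
    (hε : ε ≠ 0) : ∃ Y ⊆ W, MeasurableSet Y ∧ μ Y ≤ ε ∧ ∀ x ∈ W, ∃ y ∈ Y, F.Reachable x y := by
  obtain ⟨r, hr⟩ := ENNReal.exists_inv_nat_lt hε
  obtain ⟨Y, hYW, hY, hsep, hmax⟩ := H.exists_maximal_separated hFG hF (2 * r) hW
  refine ⟨Y, hYW, hY,
    (H.measure_le_inv_of_separated hFG hF r hY (hYW.trans hfar) hsep).trans hr.le, fun x hx => ?_⟩
  obtain ⟨y, hy, hxy⟩ := hmax x hx
  exact ⟨y, hy, SimpleGraph.reachable_of_edist_ne_top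
    (ne_top_of_le_ne_top (ENat.natCast_ne_top _) hxy)⟩

/-- If `Z` has small measure, then for most of the points whose component meets `W`, some point
of `W` in this component is far from `Z`. -/
lemma exists_measure_absorbed_le (H : IsExhaustedBy G μ D h) (hG : IsBorelGraph G) (hFG : F ≤ G)
    (hF : IsBorelGraph F) (d : ℕ) {W : Set V} (hW : MeasurableSet W) {δ : ENNReal} (hδ : δ ≠ 0) :
    ∃ η : ENNReal, η ≠ 0 ∧ ∀ Z : Set V, MeasurableSet Z → μ Z ≤ η →
      μ {x | (∃ w ∈ W, F.Reachable x w) ∧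
        ∀ w ∈ W, F.Reachable x w → ∃ z ∈ Z, G.edist w z ≤ d} ≤ δ := by
  obtain ⟨C, hC⟩ := H.exists_measure_near_le d
  let A : ℕ → Set V := fun l => D l ∩ (h l ⁻¹' W ∩ {x | F.Reachable x (h l x)})
  have hA : ∀ l, MeasurableSet (A l) := fun l => (H.measurableSet_dom l).inter
    ((H.measurable_map l hW).inter (H.measurableSet_map_reachable hFG hF l))
  let S : ℕ → Set V := fun n => (⋃ l, A l) \ ⋃ l ∈ Set.Iio n, A l
  have hS : ∀ n, MeasurableSet (S n) := fun n =>
    (MeasurableSet.iUnion hA).diff (.biUnion (Set.to_countable _) fun l _ => hA l)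
  have hanti : Antitone S := fun m n hmn =>
    Set.sdiff_subset_sdiff_right (Set.biUnion_mono (Set.Iio_subset_Iio hmn) fun _ _ => subset_rfl)
  have hempty : ⋂ n, S n = ∅ := by
    refine Set.eq_empty_of_forall_notMem fun x hx => ?_
    rw [Set.mem_iInter] at hx
    obtain ⟨l, hl⟩ := Set.mem_iUnion.1 (hx 0).1
    exact (hx (l + 1)).2 (Set.mem_biUnion (Nat.lt_succ_self l) hl)
  have hlim := tendsto_measure_iInter_atTop (μ := μ) (fun n => (hS n).nullMeasurableSet) hanti
    ⟨0, measure_ne_top _ _⟩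
  rw [hempty, measure_empty] at hlim
  obtain ⟨n, hn⟩ := (hlim.eventually (gt_mem_nhds (ENNReal.half_pos hδ))).exists
  -- Off `S n`, one of `n` maps sends the point to a vertex within `d` of `Z`, which costs at most
  -- `n * C * μ Z`.
  have hη : δ / 2 / (n * C + 1) ≠ 0 := by
    refine ENNReal.div_ne_zero.2 ⟨(ENNReal.half_pos hδ).ne', ?_⟩
    exact_mod_cast ENNReal.natCast_ne_top (n * C + 1)
  refine ⟨_, hη, fun Z hZ hZη => ?_⟩
  have hB := H.measurableSet_near le_rfl hG d hZ
  set B := {x | ∃ z ∈ Z, G.edist x z ≤ d}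
  calc μ {x | (∃ w ∈ W, F.Reachable x w) ∧
        ∀ w ∈ W, F.Reachable x w → ∃ z ∈ Z, G.edist w z ≤ d}
      ≤ μ (S n ∪ ⋃ l ∈ Finset.range n, D l ∩ h l ⁻¹' B) := by
        refine measure_mono ?_
        rintro x ⟨⟨w, hw, hxw⟩, hx⟩
        by_cases hxn : ∃ l < n, x ∈ A l
        · obtain ⟨l, hln, hl⟩ := hxn
          exact .inr (Set.mem_biUnion (Finset.mem_coe.2 (Finset.mem_range.2 hln))
            ⟨hl.1, hx _ hl.2.1 hl.2.2⟩)
        · obtain ⟨l, hl, rfl⟩ := H.exists_of_reachable hFG hxw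
          refine .inl ⟨Set.mem_iUnion.2 ⟨l, hl, hw, hxw⟩, fun hmem => hxn ?_⟩
          obtain ⟨m, hm, hxm⟩ := Set.mem_iUnion₂.1 hmem
          exact ⟨m, hm, hxm⟩
    _ ≤ μ (S n) + ∑ l ∈ Finset.range n, μ (D l ∩ h l ⁻¹' B) :=
        (measure_union_le _ _).trans (by gcongr; exact measure_biUnion_finset_le _ _)
    _ ≤ δ / 2 + ∑ _l ∈ Finset.range n, C * μ Z := by
        gcongr with l
        · exact hn.le
        · exact (H.measure_preimage_le l hB).trans (hC Z hZ)
    _ ≤ δ / 2 + (n * C + 1) * (δ / 2 / (n * C + 1)) := by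
        rw [Finset.sum_const, Finset.card_range, nsmul_eq_mul, ← mul_assoc]
        gcongr
        exact le_self_add
    _ ≤ δ / 2 + δ / 2 := by
        gcongr
        exact ENNReal.mul_div_le
    _ = δ := ENNReal.add_halves δ

end IsExhaustedBy

/-! ### Finite and infinite components after adding or removing a matching. -/

section Combinatorics

variable {V : Type*} {F G M : SimpleGraph V}

lemma IsEdgeMatching.eq_of_adj (hM : IsEdgeMatching M) {v a b : V} (ha : M.Adj v a)
    (hb : M.Adj v b) : a = b := by
  by_contra hne
  exact hM (M.mem_edgeSet.2 ha) (M.mem_edgeSet.2 hb) (fun e => hne (Sym2.congr_right.1 e)) v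
    (Sym2.mem_mk_left v a) (Sym2.mem_mk_left v b)

lemma isEdgeMatching_of_eq_of_adj (hM : ∀ v a b, M.Adj v a → M.Adj v b → a = b) :
    IsEdgeMatching M := by
  intro e he f hf hne v hve hvf
  obtain ⟨a, rfl⟩ := Sym2.mem_iff_exists.1 hve
  obtain ⟨b, rfl⟩ := Sym2.mem_iff_exists.1 hvf
  exact hne (by rw [hM v a b he hf])

lemma finite_supp_of_closed {x : V} {s : Set V} (hs : s.Finite) (hx : x ∈ s)
    (hclosed : ∀ v ∈ s, ∀ w, F.Adj v w → w ∈ s) : (F.connectedComponentMk x).supp.Finite := by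
  refine hs.subset fun y hy => ?_
  rw [SimpleGraph.ConnectedComponent.mem_supp_iff, SimpleGraph.ConnectedComponent.eq] at hy
  obtain ⟨p⟩ := hy.symm
  clear hy
  induction p with
  | nil => exact hx
  | cons hadj p ih => exact ih (hclosed _ hx _ hadj)

lemma infiniteComponentVerts_mono (h : F ≤ G) :
    infiniteComponentVerts F ⊆ infiniteComponentVerts G := fun x hx =>
  hx.mono fun y hy => by
    rw [SimpleGraph.ConnectedComponent.mem_supp_iff, SimpleGraph.ConnectedComponent.eq] at hy ⊢
    exact hy.mono h

lemma farReachingVerts_subset : farReachingVerts F ⊆ infiniteComponentVerts F := by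
  intro x hx
  choose y hy using hx
  refine Set.infinite_of_injective_forall_mem (f := y) (fun d d' hd => ?_) fun d => ?_
  · have := hy d'
    rw [← hd, hy d] at this
    exact_mod_cast this
  · rw [SimpleGraph.ConnectedComponent.mem_supp_iff, SimpleGraph.ConnectedComponent.eq]
    exact (SimpleGraph.reachable_of_edist_ne_top
      (ne_of_eq_of_ne (hy d) (ENat.natCast_ne_top d))).symm

lemma HasMaxDegreeLE.mono {d : ℕ} (hF : HasMaxDegreeLE G d) (h : F ≤ G) : HasMaxDegreeLE F d :=
  fun x => (Set.encard_le_encard fun _ hy => h hy).trans (hF x)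

lemma HasMaxDegreeLE.eq_or_eq (hF : HasMaxDegreeLE F 2) {v a b w : V} (ha : F.Adj v a)
    (hb : F.Adj v b) (hab : a ≠ b) (hw : F.Adj v w) : w = a ∨ w = b := by
  by_contra! hne
  have hsub : ({w, a, b} : Set V) ⊆ F.neighborSet v := by
    rintro _ (rfl | rfl | rfl)
    exacts [hw, ha, hb]
  have hle := (Set.encard_le_encard hsub).trans (hF v)
  rw [Set.encard_insert_of_notMem (by simp [hne.1, hne.2]), Set.encard_pair hab] at hle
  exact absurd hle (by decide)

/-- In a graph of maximum degree two, a component with two vertices of degree at most one is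
finite. -/
lemma HasMaxDegreeLE.finite_supp (hF : HasMaxDegreeLE F 2) {a b : V} (hab : a ≠ b)
    (hr : F.Reachable a b) (ha : (F.neighborSet a).Subsingleton)
    (hb : (F.neighborSet b).Subsingleton) : (F.connectedComponentMk a).supp.Finite := by
  classical
  obtain ⟨p, hp⟩ := hr.exists_isPath
  have hpos : 0 < p.length := by
    rw [Nat.pos_iff_ne_zero]
    exact fun h0 => hab (p.eq_of_length_eq_zero h0)
  -- A path from `a` to `b` is closed under adjacency: its ends have no further neighbour, and its
  -- inner vertices already have two.
  refine finite_supp_of_closed (s := {v | v ∈ p.support}) p.support.finite_toSet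
    p.start_mem_support fun v hv w hw => ?_
  obtain ⟨i, rfl, hi⟩ := SimpleGraph.Walk.mem_support_iff_exists_getVert.1 hv
  have hsucc : i < p.length → F.Adj (p.getVert i) (p.getVert (i + 1)) :=
    fun h => p.adj_getVert_succ h
  have hpred : 0 < i → F.Adj (p.getVert i) (p.getVert (i - 1)) := fun h => by
    have := p.adj_getVert_succ (i := i - 1) (by omega)
    rw [Nat.sub_add_cancel h] at this
    exact this.symm
  rcases Nat.eq_zero_or_pos i with rfl | hi0
  · have h1 := hsucc hpos
    rw [SimpleGraph.Walk.getVert_zero] at h1 hw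
    rw [ha hw h1]
    exact p.getVert_mem_support _
  rcases hi.eq_or_lt with rfl | hil
  · have h1 := hpred hi0
    rw [SimpleGraph.Walk.getVert_length] at h1 hw
    rw [hb hw h1]
    exact p.getVert_mem_support _
  · have hne : p.getVert (i - 1) ≠ p.getVert (i + 1) := fun e => by
      have := hp.getVert_injOn (show i - 1 ≤ p.length by omega) (show i + 1 ≤ p.length by omega) e
      omega
    rcases hF.eq_or_eq (hpred hi0) (hsucc hil) hne hw with rfl | rfl <;>
    exact p.getVert_mem_support _

/-- The vertices of infinite components that have a vertex of degree at most one. -/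
def rayVerts (F : SimpleGraph V) : Set V :=
  {x | x ∈ infiniteComponentVerts F ∧ ∃ y, F.Reachable x y ∧ (F.neighborSet y).Subsingleton}

/-- The vertices of infinite components of `F` that contain no edge of `M`. -/
def unhitVerts (F M : SimpleGraph V) : Set V :=
  {x | x ∈ infiniteComponentVerts F ∧ ∀ y z, F.Reachable x y → F.Adj y z → ¬ M.Adj y z}

lemma HasMaxDegreeLE.infiniteComponentVerts_sdiff_subset (hF : HasMaxDegreeLE F 2) :
    infiniteComponentVerts (F \ M) ⊆ rayVerts (F \ M) ∪ unhitVerts F M := by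
  intro x hx
  by_cases hend : ∃ y, (F \ M).Reachable x y ∧ ((F \ M).neighborSet y).Subsingleton
  · exact .inl ⟨hx, hend⟩
  · push Not at hend
    -- Two surviving neighbours are already all the `F`-neighbours, so no edge was removed at `y`.
    have hadj : ∀ y z, (F \ M).Reachable x y → F.Adj y z → (F \ M).Adj y z := by
      intro y z hy hz
      obtain ⟨a, ha, b, hb, hab⟩ := hend y hy
      rcases hF.eq_or_eq (sdiff_le (a := F) ha) (sdiff_le (a := F) hb) hab hz with rfl | rfl
      exacts [ha, hb]
    have hreach : ∀ y, F.Reachable x y → (F \ M).Reachable x y := by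
      rintro y hxy
      refine hxy.elim fun p => ?_
      have : ∀ u v (_ : F.Walk u v), (F \ M).Reachable x u → (F \ M).Reachable x v := by
        intro u v p
        induction p with
        | nil => exact id
        | cons h p ih => exact fun hu => ih (hu.trans (hadj _ _ hu h).reachable)
      exact this x y p .rfl
    refine .inr ⟨infiniteComponentVerts_mono sdiff_le hx, fun y z hy hz hM => ?_⟩
    have h1 := hadj y z (hreach y hy) hz
    rw [SimpleGraph.sdiff_adj] at h1
    exact h1.2 hM

/-- If the edges of `M` are at distance greater than one from each other, then adding a matching
to `M` produces finite components only. -/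
lemma IsEdgeMatching.infiniteComponentVerts_sup_eq_empty (hF : IsEdgeMatching F) (hFG : F ≤ G)
    (hM : ∀ a b c d, M.Adj a b → M.Adj c d → G.edist a c ≤ 1 → (c = a ∧ d = b) ∨ (c = b ∧ d = a)) :
    infiniteComponentVerts (F ⊔ M) = ∅ := by
  have hFss : ∀ v, (F.neighborSet v).Finite := fun v =>
    Set.Subsingleton.finite fun a ha b hb => hF.eq_of_adj ha hb
  have hMM : ∀ {v a b}, M.Adj v a → M.Adj v b → b = a := fun {v a b} ha hb => by
    rcases hM v a v b ha hb (by simp) with h | h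
    exacts [h.2, (ha.ne h.1).elim]
  refine Set.eq_empty_of_forall_notMem fun x hx => hx ?_
  by_cases hnear : ∃ a b, M.Adj a b ∧ (x = a ∨ F.Adj a x)
  · obtain ⟨a, b, hab, hax⟩ := hnear
    -- An `F`-partner of `a` is too close to the edge `ab` to lie on another edge of `M`.
    have key : ∀ {a b v w}, M.Adj a b → F.Adj a v → (F ⊔ M).Adj v w → w = a ∨ w = b := by
      rintro a b v w hab hav (hvw | hvw)
      · exact .inl (hF.eq_of_adj hvw hav.symm)
      · have h1 := hM a b v w hab hvw
          (SimpleGraph.edist_le_one_iff_adj_or_eq.2 (.inl (hFG hav)))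
        tauto
    refine finite_supp_of_closed (s := {a, b} ∪ (F.neighborSet a ∪ F.neighborSet b))
      ((Set.toFinite _).union ((hFss a).union (hFss b))) ?_ ?_
    · rcases hax with rfl | hax
      · simp
      · exact .inr (.inl hax)
    · rintro v ((rfl | rfl) | (hv | hv)) w hw
      · rcases hw with hw | hw
        · exact .inr (.inl hw)
        · exact .inl (.inr (hMM hab hw))
      · rcases hw with hw | hw
        · exact .inr (.inr hw)
        · exact .inl (.inl (hMM hab.symm hw))
      · exact .inl (key hab hv hw)
      · exact .inl (key hab.symm hv hw).symm
  · push Not at hnear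
    refine finite_supp_of_closed (s := {x} ∪ F.neighborSet x)
      ((Set.finite_singleton x).union (hFss x)) (.inl rfl) ?_
    rintro v (rfl | hv) w (hw | hw)
    · exact .inr hw
    · exact ((hnear v w hw).1 rfl).elim
    · exact .inl (hF.eq_of_adj hw hv.symm)
    · exact ((hnear v w hw).2 hv.symm).elim

end Combinatorics

/-! ### Rays are negligible. -/

namespace IsExhaustedBy

variable {V : Type*} [MeasurableSpace V] {G F : SimpleGraph V} {μ : Measure V}
  {D : ℕ → Set V} {h : ℕ → V → V}

lemma measurableSet_map_adj (H : IsExhaustedBy G μ D h) (hF : IsBorelGraph F) (l : ℕ) :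
    MeasurableSet {x | F.Adj x (h l x)} :=
  (measurable_id.prodMk (H.measurable_map l)) hF

variable [StandardBorelSpace V]

lemma measurableSet_subsingleton_neighborSet (H : IsExhaustedBy G μ D h) (hFG : F ≤ G)
    (hF : IsBorelGraph F) : MeasurableSet {x | (F.neighborSet x).Subsingleton} := by
  have : {x | (F.neighborSet x).Subsingleton} =
      (⋃ l, ⋃ m, {x | F.Adj x (h l x)} ∩ {x | F.Adj x (h m x)} ∩ {x | h l x = h m x}ᶜ)ᶜ := by
    ext x
    simp only [Set.mem_ofPred_eq, Set.mem_compl_iff, Set.mem_iUnion, Set.mem_inter_iff, not_exists]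
    constructor
    · rintro hss l m ⟨⟨hl, hm⟩, hne⟩
      exact hne (hss hl hm)
    · intro hall a ha b hb
      obtain ⟨l, -, rfl⟩ := H.exists_of_adj hFG ha
      obtain ⟨m, -, rfl⟩ := H.exists_of_adj hFG hb
      by_contra hne
      exact hall l m ⟨⟨ha, hb⟩, hne⟩
  rw [this]
  exact (MeasurableSet.iUnion fun l => .iUnion fun m =>
    ((H.measurableSet_map_adj hF l).inter (H.measurableSet_map_adj hF m)).inter
      (measurableSet_eq_fun (H.measurable_map l) (H.measurable_map m)).compl).compl

/-- An infinite component has at most one vertex of degree at most one, so these endpoints form a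
null set, and so does the union of their components. -/
lemma measure_rayVerts [IsProbabilityMeasure μ] (H : IsExhaustedBy G μ D h) (hFG : F ≤ G)
    (hF : IsBorelGraph F) (hdeg : HasMaxDegreeLE F 2) : μ (rayVerts F) = 0 := by
  have hY := (H.measurableSet_farReachingVerts hFG hF).inter
    (H.measurableSet_subsingleton_neighborSet hFG hF)
  refine H.measure_eq_zero_of_reachable hFG hY
    (H.measure_eq_zero_of_not_reachable hFG hF hY Set.inter_subset_left ?_) ?_
  · rintro a ⟨ha, hass⟩ b ⟨-, hbss⟩ hab hr
    exact farReachingVerts_subset ha (hdeg.finite_supp hab hr hass hbss)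
  · rintro x ⟨hx, y, hxy, hy⟩
    refine ⟨y, ⟨H.infiniteComponentVerts_subset hFG ?_, hy⟩, hxy⟩
    have : F.connectedComponentMk y = F.connectedComponentMk x :=
      SimpleGraph.ConnectedComponent.eq.2 hxy.symm
    simpa only [infiniteComponentVerts, Set.mem_ofPred_eq, this] using hx

end IsExhaustedBy

/-! ### Construction of the matching. -/

/-- The graph whose edges are the pairs related by `P`. -/
def symmGraph {V : Type*} {G : SimpleGraph V} (P : V → V → Prop)
    (hP : ∀ a b, P a b → G.Adj a b) : SimpleGraph V where
  Adj a b := P a b ∨ P b a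
  symm := ⟨fun _ _ => Or.symm⟩
  loopless := ⟨fun a h => (h.elim (hP a a) (hP a a)).ne rfl⟩

/-- If two edges have ends within distance 1, their `P`-sources are within 1 + 1 + 1. This is the
origin of the radius 3. -/
lemma symmGraph_separated {V : Type*} {G : SimpleGraph V} {P : V → V → Prop}
    (hP : ∀ a b, P a b → G.Adj a b)
    (hsep : ∀ a b c d, P a b → P c d → G.edist a c ≤ 3 → a = c ∧ b = d) (a b c d : V)
    (hab : (symmGraph P hP).Adj a b) (hcd : (symmGraph P hP).Adj c d) (hac : G.edist a c ≤ 1) :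
    (c = a ∧ d = b) ∨ (c = b ∧ d = a) := by
  have hone : ∀ {x y}, P x y → G.edist x y ≤ 1 := fun h =>
    SimpleGraph.edist_le_one_iff_adj_or_eq.2 (.inl (hP _ _ h))
  have htri : ∀ {x y z : V} {m n : ℕ∞}, G.edist x y ≤ m → G.edist y z ≤ n →
      G.edist x z ≤ m + n := fun h1 h2 => SimpleGraph.edist_triangle.trans (add_le_add h1 h2)
  have h12 : (1 + 1 : ℕ∞) ≤ 3 := by norm_num
  have h13 : (1 + 1 + 1 : ℕ∞) ≤ 3 := by norm_num
  rcases hab with hab | hab <;> rcases hcd with hcd | hcd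
  · obtain ⟨rfl, rfl⟩ := hsep _ _ _ _ hab hcd (hac.trans (by norm_num))
    exact .inl ⟨rfl, rfl⟩
  · obtain ⟨rfl, rfl⟩ := hsep _ _ _ _ hab hcd
      ((htri hac (SimpleGraph.edist_comm.trans_le (hone hcd))).trans h12)
    exact .inr ⟨rfl, rfl⟩
  · obtain ⟨rfl, rfl⟩ := hsep _ _ _ _ hab hcd ((htri (hone hab) hac).trans h12)
    exact .inr ⟨rfl, rfl⟩
  · obtain ⟨rfl, rfl⟩ := hsep _ _ _ _ hab hcd
      ((htri (htri (hone hab) hac) (SimpleGraph.edist_comm.trans_le (hone hcd))).trans h13)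
    exact .inl ⟨rfl, rfl⟩

/-- A choice that is possible for every size bound can be made successively, so that the choices
made after any given one have a total size within a bound depending on it. -/
lemma exists_seq_of_forall_size {α : Type*} (size : α → ENNReal) (p : ℕ → α → ENNReal → Prop)
    (hstep : ∀ t ε, ε ≠ 0 → ∃ a η, size a ≤ ε ∧ η ≠ 0 ∧ p t a η) :
    ∃ (a : ℕ → α) (η : ℕ → ENNReal),
      ∀ t, p t (a t) (η t) ∧ ∑' s, size (a (t + 1 + s)) ≤ η t := by
  have hstep' : ∀ (t : ℕ) (ε : {ε : ENNReal // ε ≠ 0}), ∃ (a : α) (η : {ε : ENNReal // ε ≠ 0}),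
      size a ≤ ε ∧ p t a η := by
    rintro t ⟨ε, hε⟩
    obtain ⟨a, η, h1, h2, h3⟩ := hstep t ε hε
    exact ⟨a, ⟨η, h2⟩, h1, h3⟩
  choose a η hsize hp using hstep'
  -- Halving and capping by `η` at each step gives a geometric series of sizes after stage `t`, with
  -- sum at most `η t`.
  let c : ℕ → {ε : ENNReal // ε ≠ 0} := fun n => n.rec ⟨1, one_ne_zero⟩ fun t ε =>
    ⟨min ε.1 (η t ε).1 / 2,
      (ENNReal.half_pos (lt_min ε.2.bot_lt (η t ε).2.bot_lt).ne').ne'⟩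
  have hc : ∀ t, (c (t + 1)).1 = min (c t).1 (η t (c t)).1 / 2 := fun _ => rfl
  refine ⟨fun t => a t (c t), fun t => η t (c t), fun t => ⟨hp _ _, ?_⟩⟩
  have hbound : ∀ s, (c (t + 1 + s)).1 ≤ (η t (c t)).1 / 2 * 2⁻¹ ^ s := by
    intro s
    induction s with
    | zero =>
      rw [add_zero, pow_zero, mul_one, hc]
      gcongr
      exact min_le_right _ _
    | succ s ih =>
      rw [← add_assoc, hc, pow_succ, ← mul_assoc, ← div_eq_mul_inv (_ * _)]
      gcongr
      exact (min_le_left _ _).trans ih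
  calc ∑' s, size (a (t + 1 + s) (c (t + 1 + s)))
      ≤ ∑' s, (η t (c t)).1 / 2 * 2⁻¹ ^ s :=
        ENNReal.tsum_le_tsum fun s => (hsize _ _).trans (hbound s)
    _ = (η t (c t)).1 := by
        rw [ENNReal.tsum_mul_left, ENNReal.tsum_geometric, ENNReal.one_sub_inv_two, inv_inv]
        exact ENNReal.div_mul_cancel two_ne_zero ENNReal.ofNat_ne_top

lemma exists_nat_seq_frequently {T : Type*} [Countable T] [Nonempty T] :
    ∃ τ : ℕ → T, ∀ (x : T) (n : ℕ), ∃ t ≥ n, τ t = x := by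
  obtain ⟨e, he⟩ := exists_surjective_nat T
  refine ⟨fun t => e t.unpair.1, fun x n => ?_⟩
  obtain ⟨m, rfl⟩ := he x
  exact ⟨Nat.pair m n, Nat.right_le_pair m n, by simp⟩

namespace IsExhaustedBy

variable {V J : Type*} [MeasurableSpace V] {G : SimpleGraph V} {μ : Measure V}
  {D : ℕ → Set V} {h : ℕ → V → V} [StandardBorelSpace V] [IsProbabilityMeasure μ]

/-- Countably many Borel subgraphs have a common Borel set of edges, at distance greater than one
from each other, that meets almost all of their infinite components. -/
lemma exists_separated_edges (H : IsExhaustedBy G μ D h) (hG : IsBorelGraph G) [Countable J]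
    [Nonempty J] (F : J → SimpleGraph V) (hFG : ∀ j, F j ≤ G) (hF : ∀ j, IsBorelGraph (F j)) :
    ∃ M ≤ G, IsBorelGraph M ∧
      (∀ a b c d, M.Adj a b → M.Adj c d → G.edist a c ≤ 1 → (c = a ∧ d = b) ∨ (c = b ∧ d = a)) ∧
      ∀ j, μ (unhitVerts (F j) M) = 0 := by
  obtain ⟨U, hU, hcov, hsep⟩ := H.exists_cover_separated le_rfl hG 3
  obtain ⟨τ, hτ⟩ := exists_nat_seq_frequently (T := J × ℕ × ℕ)
  -- Sources of edges of type `(j, l, c)`: the edge is `x` to `h l x` in `F j`, and `x` has colour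
  -- `c`.
  let B : J × ℕ × ℕ → Set V := fun q => farReachingVerts (F q.1) ∩
    (D q.2.1 ∩ ({x | (F q.1).Adj x (h q.2.1 x)} ∩ U q.2.2))
  have hB : ∀ q, MeasurableSet (B q) := fun q =>
    (H.measurableSet_farReachingVerts (hFG _) (hF _)).inter ((H.measurableSet_dom _).inter
      ((H.measurableSet_map_adj (hF _) _).inter (hU _)))
  obtain ⟨W, η, hWη⟩ := exists_seq_of_forall_size μ
    (fun t Y η => (Y ⊆ B (τ t) ∧ MeasurableSet Y ∧
      ∀ x ∈ B (τ t), ∃ y ∈ Y, (F (τ t).1).Reachable x y) ∧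
      ∀ Z : Set V, MeasurableSet Z → μ Z ≤ η →
        μ {x | (∃ w ∈ Y, (F (τ t).1).Reachable x w) ∧
          ∀ w ∈ Y, (F (τ t).1).Reachable x w → ∃ z ∈ Z, G.edist w z ≤ (3 : ℕ)} ≤ 2⁻¹ ^ t) (by
      intro t ε hε
      obtain ⟨Y, h1, h2, h3, h4⟩ := H.exists_small_subset (hFG (τ t).1) (hF (τ t).1) (hB (τ t))
        Set.inter_subset_left hε
      obtain ⟨η, h5, h6⟩ := H.exists_measure_absorbed_le hG (hFG (τ t).1) (hF (τ t).1) 3 h2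
        (δ := 2⁻¹ ^ t) (pow_ne_zero _ (ENNReal.inv_ne_zero.2 ENNReal.ofNat_ne_top))
      exact ⟨Y, η, h3, h5, ⟨h1, h2, h4⟩, h6⟩)
  have hWB : ∀ t, W t ⊆ B (τ t) := fun t => (hWη t).1.1.1
  have hW : ∀ t, MeasurableSet (W t) := fun t => (hWη t).1.1.2.1
  have hWmeet : ∀ t, ∀ x ∈ B (τ t), ∃ y ∈ W t, (F (τ t).1).Reachable x y :=
    fun t => (hWη t).1.1.2.2
  let Z : ℕ → Set V := fun t => ⋃ s, W (t + 1 + s)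
  have hZ : ∀ t, MeasurableSet (Z t) := fun t => .iUnion fun s => hW _
  have hZη : ∀ t, μ (Z t) ≤ η t := fun t => (measure_iUnion_le _).trans (hWη t).2
  -- Later stages have priority, so a source of `W t` survives only if it is far from all later
  -- sources.
  let S : ℕ → Set V := fun t => W t \ {x | ∃ z ∈ Z t, G.edist x z ≤ (3 : ℕ)}
  have hS : ∀ t, MeasurableSet (S t) := fun t =>
    (hW t).diff (H.measurableSet_near le_rfl hG 3 (hZ t))
  let P : V → V → Prop := fun a b => ∃ t, a ∈ S t ∧ h (τ t).2.1 a = b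
  have hP : ∀ a b, P a b → G.Adj a b := by
    rintro a _ ⟨t, ha, rfl⟩
    exact hFG _ (hWB t ha.1).2.2.1
  have hlt : ∀ {s t a c}, a ∈ S s → c ∈ S t → G.edist a c ≤ (3 : ℕ) → ¬ s < t := by
    intro s t a c ha hc hac hst
    refine ha.2 ⟨c, Set.mem_iUnion.2 ⟨t - (s + 1), ?_⟩, hac⟩
    rw [Nat.add_sub_cancel' hst]
    exact hc.1
  -- Sources from different stages are separated by priority, those from the same stage by their
  -- common colour.
  have hPsep : ∀ a b c d, P a b → P c d → G.edist a c ≤ 3 → a = c ∧ b = d := by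
    rintro a _ c _ ⟨s, ha, rfl⟩ ⟨t, hc, rfl⟩ hac
    obtain rfl : s = t := by
      have h1 := hlt ha hc hac
      have h2 := hlt hc ha (by rwa [SimpleGraph.edist_comm])
      omega
    obtain rfl : a = c := by
      by_contra hne
      exact (hsep _ (hWB s ha.1).2.2.2 (hWB s hc.1).2.2.2 hne).not_ge hac
    exact ⟨rfl, rfl⟩
  have hPmeas : MeasurableSet {p : V × V | P p.1 p.2} := by
    have : {p : V × V | P p.1 p.2} =
        ⋃ t, Prod.fst ⁻¹' S t ∩ {p | h (τ t).2.1 p.1 = p.2} := by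
      ext p
      simp [P]
    rw [this]
    exact .iUnion fun t => (measurable_fst (hS t)).inter
      (measurableSet_eq_fun ((H.measurable_map _).comp measurable_fst) measurable_snd)
  refine ⟨symmGraph P hP, ?_, hPmeas.union (measurable_swap hPmeas),
    symmGraph_separated hP hPsep, fun j => ?_⟩
  · rintro a b (hab | hab)
    exacts [hP _ _ hab, (hP _ _ hab).symm]
  · let N : J × ℕ × ℕ → Set V := fun q => {x | (∃ w ∈ B q, (F q.1).Reachable x w) ∧
      ∀ y z, (F q.1).Reachable x y → (F q.1).Adj y z → ¬ (symmGraph P hP).Adj y z}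
    have hN : ∀ q, μ (N q) = 0 := by
      intro q
      -- In a missed component every source of `W t` was discarded, so `N q` lies in the absorbed
      -- set of every stage `t` of type `q`.
      have hle : ∀ t, τ t = q → μ (N q) ≤ 2⁻¹ ^ t := by
        rintro t rfl
        refine (measure_mono ?_).trans ((hWη t).1.2 (Z t) (hZ t) (hZη t))
        rintro x ⟨⟨w, hw, hxw⟩, hx⟩
        refine ⟨?_, fun w hw hxw => ?_⟩
        · obtain ⟨y, hy, hwy⟩ := hWmeet t w hw
          exact ⟨y, hy, hxw.trans hwy⟩
        · by_contra hfar
          exact hx w _ hxw (hWB t hw).2.2.1 (.inl ⟨t, ⟨hw, hfar⟩, rfl⟩)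
      refine le_antisymm (ge_of_tendsto' (ENNReal.tendsto_pow_atTop_nhds_zero_of_lt_one
        (ENNReal.inv_lt_one.2 ENNReal.one_lt_two)) fun n => ?_) zero_le
      obtain ⟨t, htn, ht⟩ := hτ q n
      exact (hle t ht).trans
        (pow_le_pow_of_le_one zero_le (ENNReal.inv_le_one.2 ENNReal.one_lt_two.le) htn)
    refine measure_mono_null (t := ⋃ l, ⋃ c, N (j, l, c)) ?_
      (measure_iUnion_null fun l => measure_iUnion_null fun c => hN _)
    rintro x ⟨hx, hun⟩
    have hfar := H.infiniteComponentVerts_subset (hFG j) hx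
    obtain ⟨y, hy⟩ := hfar 1
    have hadj : (F j).Adj x y := SimpleGraph.edist_eq_one_iff_adj.1 (by simpa using hy)
    obtain ⟨l, hl, rfl⟩ := H.exists_of_adj (hFG j) hadj
    obtain ⟨c, hc⟩ := hcov x
    exact Set.mem_iUnion₂.2 ⟨l, c, ⟨x, ⟨hfar, hl, hadj, hc⟩, .rfl⟩, hun⟩

end IsExhaustedBy

theorem mainTheorem8 {V : Type*} [MeasurableSpace V] (G : SimpleGraph V) (μ : Measure V)
    (hG : IsGraphing G μ) (k : ℕ) (F : Fin (k + 1) → SimpleGraph V)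
    (hF_borel : ∀ j, IsBorelGraph (F j))
    (hF_cover : ⋃ j, (F j).edgeSet = G.edgeSet)
    (hF_disjoint : ∀ i j, i ≠ j → Disjoint (F i).edgeSet (F j).edgeSet)
    (hF_zero : IsEdgeMatching (F 0))
    (hF_deg : ∀ j, j ≠ 0 → HasMaxDegreeLE (F j) 2) :
    ∃ M : SimpleGraph V, M ≤ G ∧ IsBorelGraph M ∧ IsEdgeMatching M ∧
      μ (infiniteComponentVerts (F 0 ⊔ M)) = 0 ∧
      ∀ j, j ≠ 0 → μ (infiniteComponentVerts (F j \ M)) = 0 := by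
  have := hG.standardBorel
  have := hG.isProbabilityMeasure
  have hFG : ∀ j, F j ≤ G := fun j =>
    SimpleGraph.edgeSet_subset_edgeSet.1 (hF_cover ▸ Set.subset_iUnion (fun j => (F j).edgeSet) j)
  obtain ⟨D, h, H⟩ := hG.exists_isExhaustedBy
  obtain ⟨M, hMG, hM, hsep, hnull⟩ := H.exists_separated_edges hG.isBorelGraph F hFG hF_borel
  refine ⟨M, hMG, hM, isEdgeMatching_of_eq_of_adj fun v a b ha hb => ?_, ?_, fun j hj => ?_⟩
  · rcases hsep v a v b ha hb (by simp) with h | h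
    exacts [h.2.symm, (ha.ne h.1).elim]
  · rw [hF_zero.infiniteComponentVerts_sup_eq_empty (hFG 0) hsep, measure_empty]
  · have hBorel : IsBorelGraph (F j \ M) := by
      have : {p : V × V | (F j \ M).Adj p.1 p.2} =
          {p | (F j).Adj p.1 p.2} \ {p | M.Adj p.1 p.2} := by
        ext p
        simp [SimpleGraph.sdiff_adj]
      rw [IsBorelGraph, this]
      exact (hF_borel j).diff hM
    exact measure_mono_null (hF_deg j hj).infiniteComponentVerts_sdiff_subset
      (measure_union_null (H.measure_rayVerts (sdiff_le.trans (hFG j)) hBorel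
        ((hF_deg j hj).mono sdiff_le)) (hnull j))
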